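/- Let $(\Omega,\mathcal F,\mathbb P)$ be a probability space with a filtration $\{\mathcal F_n\}_{n\ge 0}$. Let $\{\epsilon_{n+1}\}_{n\ge0}$ be a real-valued martingale difference sequence with respect to $\{\mathcal F_n\}$, i.e. for every $n\ge 0$, $\epsilon_{n+1}$ is $\mathcal F_{n+1}$-measurable and integrable, and $\mathbb E[\epsilon_{n+1}\mid\mathcal F_n]=0$ a.s. Let $\{\phi_n\}_{n\ge0}$ and $\{T_n\}_{n\ge0}$ be sequences of real random variables adapted to $\{\mathcal F_n\}$ with $|\phi_n|\le T_n$ a.s. for all $n\ge0$. For $n\ge0$ put $$U_{n+1}=\sum_{k=0}^n\phi_k\,\epsilon_{k+1},\qquad \tau_n=\sum_{k=0}^nT_k^2,$$ and suppose that $\lim_{n\to\infty}\tau_n=\infty$ a.s. Suppose that $\sup_{n\ge0}\mathbb E[\epsilon_{n+1}^2\mid\mathcal F_n]\le\sigma^2$ a.s. for some constant $\sigma\ge0$. Let $\beta>0$ (not necessarily in $(0,1)$) be such that, almost surely, $$\sum_{n}T_n^{2+2\beta}\,\tau_n^{-1-\beta}\,[\ln\ln\tau_n]^{\beta}<\infty\qquad\text{and}\qquad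 \sup_{n\ge0}\mathbb E\big[|\epsilon_{n+1}|^{2+2\beta}\,\big|\,\mathcal F_n\big]<\infty,$$ where the sum is over all sufficiently large $n$ (those from which on $\tau_n>e$). Then $$\limsup_{n\to\infty}\frac{|U_{n+1}|}{\sqrt{2\,\tau_n\ln\ln\tau_n}}\le\sigma\quad\text{a.s.}$$ -/

import Mathlib

open MeasureTheory ProbabilityTheory Filter

/-- `{ε_{n+1}}_{n ≥ 0}` is a real martingale difference sequence for the filtration `ℱ`:
each `ε_{n+1}` is `ℱ_{n+1}`-measurable, integrable, and `𝔼[ε_{n+1} | ℱ_n] = 0` a.s.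
The value of `ε_0` plays no role. -/
structure IsMartingaleDifference {Ω : Type*} {m0 : MeasurableSpace Ω}
    (ε : ℕ → Ω → ℝ) (ℱ : Filtration ℕ m0) (μ : Measure Ω) : Prop where
  measurable : ∀ n, StronglyMeasurable[ℱ (n + 1)] (ε (n + 1))
  integrable : ∀ n, Integrable (ε (n + 1)) μ
  condExp_eq_zero : ∀ n, μ[ε (n + 1) | ℱ n] =ᵐ[μ] 0

/-- `LL(x) = ln ln x`. It is used along `x → ∞`; `Real.log` gives some real number where
`ln ln x` is undefined. -/
noncomputable def LL (x : ℝ) : ℝ := Real.log (Real.log x)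

/-- `U_{n+1} = ∑_{k=0}^{n} φ_k ε_{k+1}`, that is, `weightedSum φ ε m = ∑_{k < m} φ_k ε_{k+1}`. -/
def weightedSum {Ω : Type*} (φ ε : ℕ → Ω → ℝ) (m : ℕ) (ω : Ω) : ℝ :=
  ∑ k ∈ Finset.range m, φ k ω * ε (k + 1) ω

/-- `τ_n = ∑_{k=0}^{n} T_k²`. -/
def sumSq {Ω : Type*} (T : ℕ → Ω → ℝ) (n : ℕ) (ω : Ω) : ℝ :=
  ∑ k ∈ Finset.range (n + 1), T k ω ^ 2

/-!
The upper half of a law of the iterated logarithm for the martingale transform `∑ φ_k ε_{k+1}`,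
normalized by `τ_n = ∑ T_k²`.

It suffices to bound the sums from above by `R √(2 τ_n ln ln τ_n)` eventually, for every `R > σ`
(`ae_eventually_weightedSum_le`); applying this to `φ` and to `-φ` gives the absolute value.
An increment `φ_k ε_{k+1}` is replaced by `0` where it exceeds a small multiple `δ` of the critical
level `√(τ_k / ln ln τ_k)` (`truncTerm`). The truncation is from above only, so that it lowers the
conditional mean and no recentering is needed.

*Truncated sums* (`exists_ae_eventually_sum_truncTerm_le`). For `x` below a small threshold,
`exp x ≤ 1 + x + (1 + η) / 2 * x²`. Hence `exp (l S_n - (1 + η) / 2 * l² σ² ∑ φ_k²)` is a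
nonnegative supermartingale as long as `l` times the truncation level stays below the threshold.
Ville's inequality (`mul_measure_exists_le_le`), applied up to the geometric levels
`t = (1 + η)^k` with `l = √(2 ln ln t / t) / r` for some `r > σ`, and the Borel–Cantelli lemma
bound the truncated sums by `(1 + η)² r √(2 τ_n ln ln τ_n)`. Restricting the sums to the
indices with `τ_k ≤ t` keeps the supermartingale property, as `τ_k` is measurable at time `k`.

*Removed increments* (`ae_eventually_sum_sub_truncTerm_le`). Where `φ_k ε_{k+1}` exceeds the level,
it is at most a constant times `√(τ_k ln ln τ_k) a_k |ε_{k+1}|^{2+2β}`, where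
`a_k = T_k^{2+2β} τ_k^{-1-β} (ln ln τ_k)^β` is the term of the series assumed to converge. Since the
conditional moments of order `2 + 2β` are bounded along each path, `∑ a_k |ε_{k+1}|^{2+2β}`
converges almost surely (`ae_tsum_mul_lt_top`), and a Kronecker-type argument shows that the removed
increments add up to `o(√(τ_n ln ln τ_n))`.
-/

open scoped ENNReal

/-! ### Deterministic estimates -/

lemma exp_le_quadratic_of_nonpos {x : ℝ} (hx : x ≤ 0) : Real.exp x ≤ 1 + x + x ^ 2 / 2 := by
  have h := Real.quadratic_le_exp_of_nonneg (neg_nonneg.2 hx)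
  have hpos : 0 < 1 + x + x ^ 2 / 2 := by nlinarith [sq_nonneg (x + 1)]
  have h1 : Real.exp x * Real.exp (-x) = 1 := by rw [← Real.exp_add]; simp
  have h2 : 1 ≤ (1 + x + x ^ 2 / 2) * Real.exp (-x) := by
    calc (1 : ℝ) ≤ (1 + x + x ^ 2 / 2) * (1 + -x + (-x) ^ 2 / 2) := by
          nlinarith [sq_nonneg (x ^ 2)]
      _ ≤ _ := by gcongr
  nlinarith [Real.exp_pos (-x), Real.exp_pos x]

/-- To the left of a small threshold, the exponential is dominated by a quadratic polynomial whose
leading coefficient exceeds `1 / 2` as little as desired. No lower bound on `x` is needed, so that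
truncating a random variable from above is enough to control its exponential moments. -/
lemma exists_forall_exp_le_quadratic {η : ℝ} (hη : 0 < η) :
    ∃ s > 0, ∀ x ≤ s, Real.exp x ≤ 1 + x + (1 + η) / 2 * x ^ 2 := by
  refine ⟨min 1 η, lt_min one_pos hη, fun x hx => ?_⟩
  rcases le_total x 0 with h0 | h0
  · have := exp_le_quadratic_of_nonpos h0
    nlinarith [mul_nonneg hη.le (sq_nonneg x)]
  · have h1 : x ≤ 1 := hx.trans (min_le_left _ _)
    have h2 : x ≤ η := hx.trans (min_le_right _ _)
    have := Real.exp_bound' h0 h1 (n := 3) (by norm_num)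
    simp [Finset.sum_range_succ, Nat.factorial] at this
    nlinarith [mul_le_mul_of_nonneg_right h2 (sq_nonneg x), mul_nonneg h0 (sq_nonneg x)]

/-- The critical truncation level `√(x / ln ln x)` of the law of the iterated logarithm, set to `0`
below `e^e`, which makes it monotone on the whole line. -/
noncomputable def truncLevel (x : ℝ) : ℝ :=
  if x < Real.exp (Real.exp 1) then 0 else √(x / LL x)

lemma truncLevel_nonneg (x : ℝ) : 0 ≤ truncLevel x := by
  unfold truncLevel; split_ifs <;> positivity

lemma one_le_LL {x : ℝ} (hx : Real.exp (Real.exp 1) ≤ x) : 1 ≤ LL x := by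
  have hx0 : 0 < x := (Real.exp_pos _).trans_le hx
  have h1 : Real.exp 1 ≤ Real.log x := (Real.le_log_iff_exp_le hx0).2 hx
  exact (Real.le_log_iff_exp_le ((Real.exp_pos _).trans_le h1)).2 h1

lemma LL_mono {x y : ℝ} (hx : 1 < x) (hxy : x ≤ y) : LL x ≤ LL y :=
  Real.log_le_log (Real.log_pos hx) (Real.log_le_log (by linarith) hxy)

lemma one_lt_exp_exp_one : 1 < Real.exp (Real.exp 1) := Real.one_lt_exp_iff.2 (Real.exp_pos 1)

lemma LL_div_antitone {x y : ℝ} (hx : Real.exp (Real.exp 1) ≤ x) (hxy : x ≤ y) :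
    LL y / y ≤ LL x / x := by
  have key : ∀ z, Real.exp (Real.exp 1) ≤ z → Real.exp 1 ≤ Real.log z ∧ Real.exp 1 ≤ z := by
    intro z hz
    refine ⟨(Real.le_log_iff_exp_le ((Real.exp_pos _).trans_le hz)).2 hz, ?_⟩
    refine le_trans ?_ hz
    linarith [Real.add_one_le_exp (Real.exp 1)]
  obtain ⟨hlx, hx1⟩ := key x hx
  obtain ⟨hly, hy1⟩ := key y (hx.trans hxy)
  have hx0 : 0 < x := (Real.exp_pos _).trans_le hx1
  have hy0 : 0 < y := (Real.exp_pos _).trans_le hy1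
  have hlx0 : 0 < Real.log x := (Real.exp_pos _).trans_le hlx
  have hly0 : 0 < Real.log y := (Real.exp_pos _).trans_le hly
  have h1 : LL y / Real.log y ≤ LL x / Real.log x :=
    Real.log_div_self_antitoneOn hlx hly (Real.log_le_log hx0 hxy)
  have h2 : Real.log y / y ≤ Real.log x / x := Real.log_div_self_antitoneOn hx1 hy1 hxy
  have h3 : 0 ≤ LL x / Real.log x := div_nonneg (by linarith [one_le_LL hx]) hlx0.le
  calc LL y / y = LL y / Real.log y * (Real.log y / y) := by field_simp
    _ ≤ LL x / Real.log x * (Real.log x / x) := mul_le_mul h1 h2 (by positivity) h3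
    _ = LL x / x := by field_simp

lemma truncLevel_mono : Monotone truncLevel := by
  intro x y hxy
  by_cases hx : x < Real.exp (Real.exp 1)
  · rw [truncLevel, if_pos hx]; exact truncLevel_nonneg y
  rw [truncLevel, truncLevel, if_neg hx, if_neg (by linarith)]
  rw [not_lt] at hx
  have hx0 : 0 < x := (Real.exp_pos _).trans_le hx
  have hLx := one_le_LL hx
  apply Real.sqrt_le_sqrt
  rw [← inv_div (LL x), ← inv_div (LL y)]
  exact inv_anti₀ (div_pos (by linarith [one_le_LL (hx.trans hxy)]) (by linarith))
    (LL_div_antitone hx hxy)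

/-- The exponent `√(2 ln ln t / t) / r` used up to level `t` is of the order of the inverse
truncation level. -/
lemma sqrt_div_mul_truncLevel_le {r : ℝ} (hr : 0 < r) (t : ℝ) :
    √(2 * LL t / t) / r * truncLevel t ≤ √2 / r := by
  by_cases ht : t < Real.exp (Real.exp 1)
  · rw [truncLevel, if_pos ht, mul_zero]; positivity
  rw [truncLevel, if_neg ht]
  rw [not_lt] at ht
  have ht0 : 0 < t := (Real.exp_pos _).trans_le ht
  have hL := one_le_LL ht
  rw [div_mul_eq_mul_div, ← Real.sqrt_mul (by positivity)]
  have : 2 * LL t / t * (t / LL t) = 2 := by field_simp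
  rw [this]

lemma measurable_LL : Measurable LL := Real.measurable_log.comp Real.measurable_log

lemma measurable_truncLevel : Measurable truncLevel :=
  Measurable.ite measurableSet_Iio measurable_const
    (measurable_id.div measurable_LL).sqrt

lemma sumSq_mono {Ω : Type*} (T : ℕ → Ω → ℝ) (ω : Ω) : Monotone fun n => sumSq T n ω :=
  monotone_nat_of_le_succ fun n => by
    unfold sumSq; rw [Finset.sum_range_succ _ (n + 1)]; linarith [sq_nonneg (T (n + 1) ω)]

lemma tendsto_LL_atTop : Tendsto LL atTop atTop :=
  Real.tendsto_log_atTop.comp Real.tendsto_log_atTop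

lemma LL_pow {ρ : ℝ} (k : ℕ) : LL (ρ ^ k) = Real.log (k * Real.log ρ) := by
  rw [LL, Real.log_pow]

lemma eventually_LL_pow_succ_le {ρ η : ℝ} (hρ : 1 < ρ) (hη : 0 < η) :
    ∀ᶠ k : ℕ in atTop, LL (ρ ^ (k + 1)) ≤ (1 + η) * LL (ρ ^ k) := by
  have hlog := Real.log_pos hρ
  have h := (tendsto_LL_atTop.comp (tendsto_pow_atTop_atTop_of_one_lt hρ)).eventually_ge_atTop
    (Real.log 2 / η)
  filter_upwards [h, eventually_ge_atTop 1] with k hk hk1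
  have hk1' : (1 : ℝ) ≤ k := by exact_mod_cast hk1
  have h2 : LL (ρ ^ (k + 1)) ≤ Real.log 2 + LL (ρ ^ k) := by
    rw [LL_pow, LL_pow, ← Real.log_mul (by norm_num) (by positivity)]
    apply Real.log_le_log (by positivity)
    push_cast
    nlinarith
  rw [Function.comp_apply, div_le_iff₀ hη] at hk
  linarith

/-- This is the summability behind the Borel–Cantelli argument along geometric blocks. -/
lemma summable_exp_neg_LL_pow {ρ η : ℝ} (hρ : 1 < ρ) (hη : 0 < η) :
    Summable fun k : ℕ => Real.exp (-((1 + η) * LL (ρ ^ k))) := by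
  have hlog := Real.log_pos hρ
  have h : Summable fun k : ℕ => Real.log ρ ^ (-(1 + η)) * (k : ℝ) ^ (-(1 + η)) :=
    (Real.summable_nat_rpow.2 (by linarith)).mul_left _
  refine h.congr_atTop ?_
  filter_upwards [eventually_ge_atTop 1] with k hk1
  have hk0 : (0 : ℝ) < k := by exact_mod_cast hk1
  rw [LL_pow, mul_comm, ← Real.mul_rpow hk0.le hlog.le, Real.rpow_def_of_pos (by positivity)]
  congr 1; ring

/-! ### Conditional expectations and supermartingales -/

/-- Pulling an `m`-measurable factor out of a `[0, ∞]`-valued conditional expectation. -/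
lemma lintegral_mul_condLExp {Ω : Type*} {m m0 : MeasurableSpace Ω} {μ : Measure Ω}
    (hm : m ≤ m0) [SigmaFinite (μ.trim hm)] {a X : Ω → ℝ≥0∞} (ha : Measurable[m] a)
    (hX : Measurable X) :
    ∫⁻ ω, a ω * (μ⁻[X | m]) ω ∂μ = ∫⁻ ω, a ω * X ω ∂μ := by
  -- Both sides integrate `a` against measures that agree on `m`.
  have htrim : (μ.withDensity (μ⁻[X | m])).trim hm = (μ.withDensity X).trim hm := by
    refine @Measure.ext _ m _ _ fun s hs => ?_
    rw [trim_measurableSet_eq hm hs, trim_measurableSet_eq hm hs, withDensity_apply _ (hm s hs),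
      withDensity_apply _ (hm s hs), setLIntegral_condLExp hm _ _ hs]
  have h : ∀ Y : Ω → ℝ≥0∞, Measurable Y →
      ∫⁻ ω, a ω * Y ω ∂μ = ∫⁻ ω, a ω ∂(μ.withDensity Y).trim hm := by
    intro Y hY
    rw [lintegral_trim hm ha, lintegral_withDensity_eq_lintegral_mul _ hY (ha.mono hm le_rfl)]
    simp [mul_comm]
  rw [h _ hX, h _ (measurable_condLExp' _ _ _), htrim]

/-- One step of the exponential supermartingale: if `g` is dominated by a quadratic polynomial in
the martingale difference, then its conditional expectation is at most that of the constant and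
quadratic terms. The coefficients need not be integrable. -/
lemma lintegral_mul_le_of_le_quadratic {Ω : Type*} {m m0 : MeasurableSpace Ω} {μ : Measure Ω}
    [IsProbabilityMeasure μ] (hm : m ≤ m0) {ε ψ Y g : Ω → ℝ} {σ K : ℝ} (hK : 0 ≤ K)
    (hεm : StronglyMeasurable ε) (hεi : Integrable ε μ) (hε : μ[ε | m] =ᵐ[μ] 0)
    (hvar : ∀ᵐ ω ∂μ, (μ⁻[fun ω => ENNReal.ofReal (ε ω ^ 2) | m]) ω ≤ ENNReal.ofReal (σ ^ 2))
    (hψ : StronglyMeasurable[m] ψ) (hY : StronglyMeasurable[m] Y) (hY0 : ∀ ω, 0 ≤ Y ω)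
    (hg0 : ∀ ω, 0 ≤ g ω) (hg : ∀ ω, g ω ≤ 1 + ψ ω * ε ω + K * (ψ ω * ε ω) ^ 2) :
    ∫⁻ ω, ENNReal.ofReal (Y ω * g ω) ∂μ ≤
      ∫⁻ ω, ENNReal.ofReal (Y ω * Real.exp (K * σ ^ 2 * ψ ω ^ 2)) ∂μ := by
  -- Localize to sets on which the coefficients are bounded.
  let B : ℕ → Set Ω := fun M => {ω | |Y ω| ≤ M} ∩ {ω | |ψ ω| ≤ M}
  have hBm : ∀ M, MeasurableSet[m] (B M) := fun M =>
    MeasurableSet.inter (hY.norm.measurable measurableSet_Iic) (hψ.norm.measurable measurableSet_Iic)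
  have hBmono : Monotone B := by
    intro M N hMN ω hω
    have : (M : ℝ) ≤ N := by exact_mod_cast hMN
    exact ⟨le_trans hω.1 this, le_trans hω.2 this⟩
  have hBU : ⋃ M, B M = Set.univ := by
    refine Set.eq_univ_of_forall fun ω => ?_
    obtain ⟨M, hM⟩ := exists_nat_ge (max |Y ω| |ψ ω|)
    exact Set.mem_iUnion.2 ⟨M, (le_max_left _ _).trans hM, (le_max_right _ _).trans hM⟩
  rw [← setLIntegral_univ, ← hBU, setLIntegral_iUnion_of_directed _ hBmono.directed_le]
  refine iSup_le fun M => ?_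
  refine le_trans ?_ (setLIntegral_le_lintegral (B M) _)
  rw [← lintegral_indicator (hm _ (hBm M)), ← lintegral_indicator (hm _ (hBm M))]
  let y : Ω → ℝ := (B M).indicator Y
  have hym : StronglyMeasurable[m] y := hY.indicator (hBm M)
  have hyψm : StronglyMeasurable[m] (fun ω => y ω * ψ ω) := hym.mul hψ
  have hyψ2m : StronglyMeasurable[m] (fun ω => K * y ω * ψ ω ^ 2) :=
    (hym.const_mul K).mul (hψ.pow 2)
  have hy0 : ∀ ω, 0 ≤ y ω := fun ω => Set.indicator_nonneg (fun ω _ => hY0 ω) ω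
  have hyM : ∀ ω, |y ω| ≤ M := by
    intro ω
    by_cases hω : ω ∈ B M
    · simpa [y, hω] using hω.1
    · simp [y, hω]
  have hyψM : ∀ ω, |y ω * ψ ω| ≤ M * M := by
    intro ω
    by_cases hω : ω ∈ B M
    · rw [abs_mul]; exact mul_le_mul (hyM ω) hω.2 (abs_nonneg _) (Nat.cast_nonneg _)
    · simp only [y, hω, Set.indicator_of_notMem, not_false_eq_true, zero_mul, abs_zero]; positivity
  have hε2i : ∫⁻ ω, ENNReal.ofReal (ε ω ^ 2) ∂μ < ∞ := by
    rw [← lintegral_condLExp hm]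
    refine (lintegral_mono_ae hvar).trans_lt ?_
    simp
  have hyi : Integrable y μ :=
    Integrable.of_bound (hym.mono hm).aestronglyMeasurable M (ae_of_all _ fun ω => hyM ω)
  have hlin : Integrable (fun ω => y ω * ψ ω * ε ω) μ :=
    hεi.bdd_mul (hyψm.mono hm).aestronglyMeasurable (ae_of_all _ fun ω => hyψM ω)
  have hlin0 : ∫ ω, y ω * ψ ω * ε ω ∂μ = 0 := by
    have h := condExp_mul_of_stronglyMeasurable_left (μ := μ) hyψm hlin hεi
    rw [← integral_condExp hm]
    refine (integral_congr_ae (h.trans ?_)).trans (integral_zero' _ _)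
    filter_upwards [hε] with ω hω
    simp [hω]
  have hquad : ∫⁻ ω, ENNReal.ofReal (K * y ω * ψ ω ^ 2 * ε ω ^ 2) ∂μ ≤
      ∫⁻ ω, ENNReal.ofReal (K * y ω * ψ ω ^ 2 * σ ^ 2) ∂μ := by
    have h0 : ∀ ω, 0 ≤ K * y ω * ψ ω ^ 2 := fun ω => by have := hy0 ω; positivity
    simp only [ENNReal.ofReal_mul (h0 _)]
    rw [← lintegral_mul_condLExp hm hyψ2m.measurable.ennreal_ofReal
      (hεm.measurable.pow_const 2).ennreal_ofReal]
    refine lintegral_mono_ae ?_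
    filter_upwards [hvar] with ω hω
    gcongr
  -- Split off the linear term, whose integral vanishes.
  have hconst : ∀ ω, (B M).indicator (fun ω => ENNReal.ofReal (Y ω * g ω)) ω ≤
      ENNReal.ofReal (y ω + y ω * ψ ω * ε ω + K * y ω * ψ ω ^ 2 * ε ω ^ 2) := by
    intro ω
    by_cases hω : ω ∈ B M
    · simp only [y, hω, Set.indicator_of_mem]
      refine ENNReal.ofReal_le_ofReal ?_
      have := mul_le_mul_of_nonneg_left (hg ω) (hY0 ω)
      nlinarith
    · simp [hω]
  have hpos : ∀ ω, 0 ≤ y ω + y ω * ψ ω * ε ω + K * y ω * ψ ω ^ 2 * ε ω ^ 2 := by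
    intro ω
    have := mul_nonneg (hy0 ω) ((hg0 ω).trans (hg ω))
    nlinarith
  have hsqi : Integrable (fun ω => K * y ω * ψ ω ^ 2 * ε ω ^ 2) μ := by
    have hε2 : Integrable (fun ω => ε ω ^ 2) μ := by
      refine ⟨(hεm.pow 2).aestronglyMeasurable, ?_⟩
      rw [hasFiniteIntegral_iff_ofReal (ae_of_all _ fun ω => sq_nonneg _)]
      exact hε2i
    refine hε2.bdd_mul (hyψ2m.mono hm).aestronglyMeasurable (c := K * (M * M * M))
      (ae_of_all _ fun ω => ?_)
    rw [Real.norm_eq_abs]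
    by_cases hω : ω ∈ B M
    · have h1 := hyψM ω
      have h2 : |ψ ω| ≤ M := hω.2
      rw [show K * y ω * ψ ω ^ 2 = K * (y ω * ψ ω * ψ ω) by ring, abs_mul, abs_of_nonneg hK,
        abs_mul]
      gcongr
    · simp only [y, hω, Set.indicator_of_notMem, not_false_eq_true, mul_zero, zero_mul, abs_zero]
      positivity
  calc ∫⁻ ω, (B M).indicator (fun ω => ENNReal.ofReal (Y ω * g ω)) ω ∂μ
      ≤ ∫⁻ ω, ENNReal.ofReal (y ω + y ω * ψ ω * ε ω + K * y ω * ψ ω ^ 2 * ε ω ^ 2) ∂μ :=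
        lintegral_mono hconst
    _ = ENNReal.ofReal (∫ ω, y ω + y ω * ψ ω * ε ω + K * y ω * ψ ω ^ 2 * ε ω ^ 2 ∂μ) :=
        (ofReal_integral_eq_lintegral_ofReal ((hyi.add hlin).add hsqi) (ae_of_all _ hpos)).symm
    _ = ENNReal.ofReal (∫ ω, y ω + K * y ω * ψ ω ^ 2 * ε ω ^ 2 ∂μ) := by
        have e1 := integral_add (hyi.add hlin) hsqi
        have e2 := integral_add hyi hlin
        have e3 := integral_add hyi hsqi
        simp only [Pi.add_apply] at e1 e2 e3
        rw [e1, e2, e3, hlin0, add_zero]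
    _ = ∫⁻ ω, ENNReal.ofReal (y ω + K * y ω * ψ ω ^ 2 * ε ω ^ 2) ∂μ :=
        ofReal_integral_eq_lintegral_ofReal (hyi.add hsqi)
          (ae_of_all _ fun ω => by have := hy0 ω; simp only [Pi.zero_apply]; positivity)
    _ = ∫⁻ ω, (ENNReal.ofReal (y ω) + ENNReal.ofReal (K * y ω * ψ ω ^ 2 * ε ω ^ 2)) ∂μ := by
        refine lintegral_congr fun ω => ENNReal.ofReal_add (hy0 ω) ?_
        have := hy0 ω; positivity
    _ ≤ ∫⁻ ω, (ENNReal.ofReal (y ω) + ENNReal.ofReal (K * y ω * ψ ω ^ 2 * σ ^ 2)) ∂μ := by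
        rw [lintegral_add_left (hym.mono hm).measurable.ennreal_ofReal,
          lintegral_add_left (hym.mono hm).measurable.ennreal_ofReal]
        gcongr
    _ ≤ ∫⁻ ω, (B M).indicator
          (fun ω => ENNReal.ofReal (Y ω * Real.exp (K * σ ^ 2 * ψ ω ^ 2))) ω ∂μ := by
        refine lintegral_mono fun ω => ?_
        by_cases hω : ω ∈ B M
        · have h0 := hY0 ω
          simp only [y, hω, Set.indicator_of_mem]
          rw [← ENNReal.ofReal_add h0 (by positivity)]
          refine ENNReal.ofReal_le_ofReal ?_
          have := mul_le_mul_of_nonneg_left (Real.add_one_le_exp (K * σ ^ 2 * ψ ω ^ 2)) h0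
          nlinarith
        · simp [y, hω]

/-- Ville's maximal inequality for nonnegative supermartingales, with the supermartingale property
expressed through integrals over the sets of the past. -/
lemma mul_measure_exists_le_le {Ω : Type*} {m0 : MeasurableSpace Ω} {μ : Measure Ω}
    {ℱ : Filtration ℕ m0} {Z : ℕ → Ω → ℝ≥0∞} (hZ : ∀ n, Measurable[ℱ n] (Z n))
    (hstep : ∀ n A, MeasurableSet[ℱ n] A → ∫⁻ ω in A, Z (n + 1) ω ∂μ ≤ ∫⁻ ω in A, Z n ω ∂μ)
    (a : ℝ≥0∞) : a * μ {ω | ∃ n, a ≤ Z n ω} ≤ ∫⁻ ω, Z 0 ω ∂μ := by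
  let S : ℕ → Set Ω := fun n => ⋃ j ∈ Set.Iic n, {ω | a ≤ Z j ω}
  have hS : ∀ n, MeasurableSet[ℱ n] (S n) := fun n =>
    MeasurableSet.biUnion (Set.to_countable _) fun j hj =>
      ℱ.mono hj _ (hZ j measurableSet_Ici)
  have hS0 : ∀ n, MeasurableSet (S n) := fun n => ℱ.le n _ (hS n)
  have hZ0 : ∀ n, Measurable (Z n) := fun n => (hZ n).mono (ℱ.le n) le_rfl
  have markov : ∀ n (D : Set Ω), (∀ ω ∈ D, a ≤ Z n ω) → MeasurableSet D →
      a * μ D ≤ ∫⁻ ω in D, Z n ω ∂μ := by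
    intro n D hD hDm
    rw [← setLIntegral_const]
    exact setLIntegral_mono' hDm hD
  have hSsucc : ∀ n, S (n + 1) = S n ∪ ((S n)ᶜ ∩ {ω | a ≤ Z (n + 1) ω}) := by
    intro n
    ext ω
    simp only [S, Set.mem_iUnion, Set.mem_Iic, Set.mem_ofPred_eq, Set.mem_union, Set.mem_inter_iff,
      Set.mem_compl_iff, exists_prop, Nat.le_succ_iff]
    grind
  -- The mass collected at the first passage plus the mass still running never increases.
  have key : ∀ n, a * μ (S n) + ∫⁻ ω in (S n)ᶜ, Z n ω ∂μ ≤ ∫⁻ ω, Z 0 ω ∂μ := by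
    intro n
    induction n with
    | zero =>
      rw [← lintegral_add_compl (μ := μ) (Z 0) (hS0 0)]
      gcongr
      exact markov 0 _ (fun ω hω => by simpa [S] using hω) (hS0 0)
    | succ n ih =>
      refine le_trans ?_ ih
      let D : Set Ω := {ω | a ≤ Z (n + 1) ω}
      have hDm : MeasurableSet D := measurableSet_le measurable_const (hZ0 (n + 1))
      have hcompl : (S (n + 1))ᶜ = (S n)ᶜ \ D := by
        rw [hSsucc]; ext ω; simp [D]; tauto
      calc a * μ (S (n + 1)) + ∫⁻ ω in (S (n + 1))ᶜ, Z (n + 1) ω ∂μ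
          ≤ a * μ (S n) + a * μ ((S n)ᶜ ∩ D) + ∫⁻ ω in (S n)ᶜ \ D, Z (n + 1) ω ∂μ := by
            rw [hcompl, ← mul_add]
            gcongr
            rw [hSsucc]
            exact measure_union_le _ _
        _ ≤ a * μ (S n) + ∫⁻ ω in (S n)ᶜ ∩ D, Z (n + 1) ω ∂μ +
              ∫⁻ ω in (S n)ᶜ \ D, Z (n + 1) ω ∂μ := by
            gcongr
            exact markov (n + 1) _ (fun ω hω => hω.2) ((hS0 n).compl.inter hDm)
        _ = a * μ (S n) + ∫⁻ ω in (S n)ᶜ, Z (n + 1) ω ∂μ := by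
            rw [add_assoc, lintegral_inter_add_sdiff _ _ hDm]
        _ ≤ _ := add_le_add le_rfl (hstep n _ (hS n).compl)
  have hU : {ω | ∃ n, a ≤ Z n ω} = ⋃ n, S n := by
    ext ω
    simp only [S, Set.mem_iUnion, Set.mem_Iic, Set.mem_ofPred_eq, exists_prop]
    exact ⟨fun ⟨n, h⟩ => ⟨n, n, le_rfl, h⟩, fun ⟨_, n, _, h⟩ => ⟨n, h⟩⟩
  have hmono : Monotone S := fun n k hnk =>
    Set.biUnion_subset_biUnion_left (Set.Iic_subset_Iic.2 hnk)
  rw [hU, hmono.measure_iUnion, ENNReal.mul_iSup]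
  exact iSup_le fun n => le_self_add.trans (key n)

/-- If the predictable weights `a j` have a finite sum and the conditional expectations of `W j`
given the past are bounded along almost every path, then `∑ a j * W j` is finite. -/
lemma ae_tsum_mul_lt_top {Ω : Type*} {m0 : MeasurableSpace Ω} {μ : Measure Ω}
    [IsProbabilityMeasure μ] {ℱ : Filtration ℕ m0} {a W : ℕ → Ω → ℝ≥0∞}
    (ha : ∀ n, Measurable[ℱ n] (a n)) (hW : ∀ n, Measurable (W n))
    (hsum : ∀ᵐ ω ∂μ, ∑' n, a n ω < ∞) (hmom : ∀ᵐ ω ∂μ, ⨆ n, (μ⁻[W n | ℱ n]) ω < ∞) :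
    ∀ᵐ ω ∂μ, ∑' n, a n ω * W n ω < ∞ := by
  let G : ℕ → ℕ → Set Ω := fun N n =>
    {ω | ∑ i ∈ Finset.range (n + 1), a i ω ≤ N} ∩ {ω | (μ⁻[W n | ℱ n]) ω ≤ N}
  have hG : ∀ N n, MeasurableSet[ℱ n] (G N n) := by
    intro N n
    have hs : Measurable[ℱ n] fun ω => ∑ i ∈ Finset.range (n + 1), a i ω :=
      Finset.measurable_fun_sum _ fun i hi =>
        (ha i).mono (ℱ.mono (Nat.lt_succ_iff.1 (Finset.mem_range.1 hi))) le_rfl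
    exact MeasurableSet.inter (hs measurableSet_Iic)
      (measurable_condLExp _ _ _ measurableSet_Iic)
  let b : ℕ → ℕ → Ω → ℝ≥0∞ := fun N n => (G N n).indicator (a n)
  have hb : ∀ N n, Measurable[ℱ n] (b N n) := fun N n => (ha n).indicator (hG N n)
  have hb0 : ∀ N n, Measurable (b N n) := fun N n => (hb N n).mono (ℱ.le n) le_rfl
  have hbsum : ∀ N ω, ∑' n, b N n ω ≤ N := by
    intro N ω
    refine ENNReal.tsum_le_of_sum_range_le fun n => ?_
    induction n with
    | zero => simp
    | succ n ih =>
      by_cases hω : ω ∈ G N n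
      · refine le_trans (Finset.sum_le_sum fun i _ => ?_) hω.1
        exact Set.indicator_le_self _ _ _
      · rw [Finset.sum_range_succ]
        simpa [b, hω] using ih
  have hfin : ∀ N : ℕ, ∀ᵐ ω ∂μ, ∑' n, b N n ω * W n ω < ∞ := by
    intro N
    refine ae_lt_top (Measurable.tsum fun n => (hb0 N n).mul (hW n)) (ne_of_lt ?_)
    rw [lintegral_tsum (f := fun n ω => b N n ω * W n ω)
      fun n => ((hb0 N n).mul (hW n)).aemeasurable]
    calc ∑' n, ∫⁻ ω, b N n ω * W n ω ∂μ
        = ∑' n, ∫⁻ ω, b N n ω * (μ⁻[W n | ℱ n]) ω ∂μ := by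
          congr 1; ext n; exact (lintegral_mul_condLExp (ℱ.le n) (hb N n) (hW n)).symm
      _ ≤ ∑' n, ∫⁻ ω, b N n ω * N ∂μ := by
          refine ENNReal.tsum_le_tsum fun n => lintegral_mono fun ω => ?_
          by_cases hω : ω ∈ G N n
          · have := hω.2
            gcongr
            exact this
          · simp [b, hω]
      _ = ∫⁻ ω, (∑' n, b N n ω) * N ∂μ := by
          rw [← lintegral_tsum fun n => ((hb0 N n).mul_const _).aemeasurable]
          simp_rw [ENNReal.tsum_mul_right]
      _ ≤ ∫⁻ _, (N : ℝ≥0∞) * N ∂μ := by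
          refine lintegral_mono fun ω => ?_
          gcongr
          exact hbsum N ω
      _ < ∞ := by simp [ENNReal.mul_lt_top]
  filter_upwards [hsum, hmom, ae_all_iff.2 hfin] with ω h1 h2 h3
  obtain ⟨N, hN⟩ := ENNReal.exists_nat_gt (max_lt h1 h2).ne
  have hmem : ∀ n, ω ∈ G N n := fun n =>
    ⟨(ENNReal.sum_le_tsum _).trans ((le_max_left _ _).trans hN.le),
      (le_iSup (fun n => (μ⁻[W n | ℱ n]) ω) n).trans ((le_max_right _ _).trans hN.le)⟩
  simpa [b, hmem] using h3 N

/-! ### The maximal inequality and the truncated sums -/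

/-- Exponential maximal inequality. The hypothesis `hle` only asks for a quadratic upper bound on
`exp (ξ n)`, which a truncation of `ψ n * ε (n + 1)` from above satisfies. -/
lemma measure_exists_le_sum_le {Ω : Type*} {m0 : MeasurableSpace Ω} {μ : Measure Ω}
    [IsProbabilityMeasure μ] {ℱ : Filtration ℕ m0} {ε ψ ξ : ℕ → Ω → ℝ} {σ K : ℝ} (hK : 0 ≤ K)
    (hε : IsMartingaleDifference ε ℱ μ)
    (hvar : ∀ n, ∀ᵐ ω ∂μ, (μ⁻[fun ω => ENNReal.ofReal (ε (n + 1) ω ^ 2) | ℱ n]) ω ≤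
      ENNReal.ofReal (σ ^ 2))
    (hψ : ∀ n, Measurable[ℱ n] (ψ n)) (hξ : ∀ n, Measurable[ℱ (n + 1)] (ξ n))
    (hle : ∀ n ω, Real.exp (ξ n ω) ≤ 1 + ψ n ω * ε (n + 1) ω + K * (ψ n ω * ε (n + 1) ω) ^ 2)
    (a : ℝ) :
    μ {ω | ∃ n, a ≤ ∑ j ∈ Finset.range n, (ξ j ω - K * σ ^ 2 * ψ j ω ^ 2)} ≤
      ENNReal.ofReal (Real.exp (-a)) := by
  let S : ℕ → Ω → ℝ := fun n ω => ∑ j ∈ Finset.range n, (ξ j ω - K * σ ^ 2 * ψ j ω ^ 2)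
  have hS : ∀ n, Measurable[ℱ n] (S n) := fun n =>
    Finset.measurable_fun_sum _ fun j hj => by
      have hj' : j + 1 ≤ n := Finset.mem_range.1 hj
      exact ((hξ j).mono (ℱ.mono hj') le_rfl).sub
        ((((hψ j).mono (ℱ.mono (by omega)) le_rfl).pow_const 2).const_mul _)
  have hstep : ∀ n A, MeasurableSet[ℱ n] A →
      ∫⁻ ω in A, ENNReal.ofReal (Real.exp (S (n + 1) ω)) ∂μ ≤
        ∫⁻ ω in A, ENNReal.ofReal (Real.exp (S n ω)) ∂μ := by
    intro n A hA
    let Y : Ω → ℝ := A.indicator fun ω => Real.exp (S n ω - K * σ ^ 2 * ψ n ω ^ 2)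
    have hY : Measurable[ℱ n] Y :=
      (Real.measurable_exp.comp ((hS n).sub (((hψ n).pow_const 2).const_mul _))).indicator hA
    have h := lintegral_mul_le_of_le_quadratic (ℱ.le n) hK
      ((hε.measurable n).mono (ℱ.le (n + 1))) (hε.integrable n) (hε.condExp_eq_zero n) (hvar n)
      (hψ n).stronglyMeasurable hY.stronglyMeasurable
      (fun ω => Set.indicator_nonneg (fun ω _ => (Real.exp_pos _).le) ω)
      (fun ω => (Real.exp_pos (ξ n ω)).le) (hle n)
    rw [← lintegral_indicator (ℱ.le n _ hA), ← lintegral_indicator (ℱ.le n _ hA)]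
    refine le_of_eq_of_le (lintegral_congr fun ω => ?_)
      (h.trans_eq (lintegral_congr fun ω => ?_))
    · by_cases hω : ω ∈ A
      · simp only [Y, hω, Set.indicator_of_mem, S, Finset.sum_range_succ]
        rw [← Real.exp_add]; congr 2; ring
      · simp [Y, hω]
    · by_cases hω : ω ∈ A
      · simp only [Y, hω, Set.indicator_of_mem]
        rw [← Real.exp_add]; congr 2; ring
      · simp [Y, hω]
  have hV := mul_measure_exists_le_le (μ := μ) (ℱ := ℱ)
    (fun n => (Real.measurable_exp.comp (hS n)).ennreal_ofReal) hstep (ENNReal.ofReal (Real.exp a))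
  have hset : {ω | ∃ n, ENNReal.ofReal (Real.exp a) ≤ ENNReal.ofReal (Real.exp (S n ω))} =
      {ω | ∃ n, a ≤ S n ω} := by
    ext ω
    simp [ENNReal.ofReal_le_ofReal_iff (Real.exp_pos _).le]
  simp only [Function.comp_apply] at hV
  rw [hset] at hV
  simp only [S, Finset.range_zero, Finset.sum_empty, Real.exp_zero, ENNReal.ofReal_one,
    lintegral_const, measure_univ, mul_one] at hV
  rw [Real.exp_neg, ENNReal.ofReal_inv_of_pos (Real.exp_pos a)]
  rw [mul_comm] at hV
  exact ENNReal.le_inv_iff_mul_le.2 hV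

/-- The increment `φ_n ε_{n+1}`, replaced by `0` where it exceeds `δ` times the critical truncation
level at `τ_n`. Negative increments are kept whatever their size. -/
noncomputable def truncTerm {Ω : Type*} (δ : ℝ) (φ ε T : ℕ → Ω → ℝ) (n : ℕ) (ω : Ω) : ℝ :=
  if φ n ω * ε (n + 1) ω ≤ δ * truncLevel (sumSq T n ω) then φ n ω * ε (n + 1) ω else 0

lemma measurable_sumSq {Ω : Type*} {m0 : MeasurableSpace Ω} {ℱ : Filtration ℕ m0}
    {T : ℕ → Ω → ℝ} (hT : StronglyAdapted ℱ T) (n : ℕ) : Measurable[ℱ n] (sumSq T n) :=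
  Finset.measurable_fun_sum _ fun i hi =>
    ((hT i).measurable.mono (ℱ.mono (Nat.lt_succ_iff.1 (Finset.mem_range.1 hi))) le_rfl).pow_const 2

lemma measurable_truncTerm {Ω : Type*} {m0 : MeasurableSpace Ω} {μ : Measure Ω}
    {ℱ : Filtration ℕ m0} {φ ε T : ℕ → Ω → ℝ} (hε : IsMartingaleDifference ε ℱ μ)
    (hφ : StronglyAdapted ℱ φ) (hT : StronglyAdapted ℱ T) (δ : ℝ) (n : ℕ) :
    Measurable[ℱ (n + 1)] (truncTerm δ φ ε T n) := by
  have h : Measurable fun p : ℝ × ℝ => if p.1 ≤ δ * truncLevel p.2 then p.1 else 0 :=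
    Measurable.ite (measurableSet_le measurable_fst
      ((measurable_truncLevel.comp measurable_snd).const_mul δ)) measurable_fst measurable_const
  have hn : ℱ n ≤ ℱ (n + 1) := ℱ.mono (Nat.le_succ n)
  exact h.comp ((((hφ n).measurable.mono hn le_rfl).mul (hε.measurable n).measurable).prodMk
    ((measurable_sumSq hT n).mono hn le_rfl))

/-- For a suitable truncation constant, the truncated sums obey the law of the iterated logarithm
up to a factor close to `1`. -/
lemma exists_ae_eventually_sum_truncTerm_le {Ω : Type*} {m0 : MeasurableSpace Ω} {μ : Measure Ω}
    [IsProbabilityMeasure μ] {ℱ : Filtration ℕ m0} {ε φ T : ℕ → Ω → ℝ} {σ r η : ℝ}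
    (hσ : 0 ≤ σ) (hr : 0 < r) (hσr : σ ≤ r) (hη : 0 < η)
    (hε : IsMartingaleDifference ε ℱ μ)
    (hφ : StronglyAdapted ℱ φ) (hT : StronglyAdapted ℱ T)
    (hφT : ∀ n, ∀ᵐ ω ∂μ, |φ n ω| ≤ T n ω)
    (hτ : ∀ᵐ ω ∂μ, Tendsto (fun n => sumSq T n ω) atTop atTop)
    (hvar : ∀ n, ∀ᵐ ω ∂μ, (μ⁻[fun ω => ENNReal.ofReal (ε (n + 1) ω ^ 2) | ℱ n]) ω ≤
      ENNReal.ofReal (σ ^ 2)) :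
    ∃ δ > 0, ∀ᵐ ω ∂μ, ∀ᶠ n in atTop,
      ∑ j ∈ Finset.range (n + 1), truncTerm δ φ ε T j ω ≤
        (1 + η) ^ 2 * r * √(2 * sumSq T n ω * LL (sumSq T n ω)) := by
  obtain ⟨s, hs, hexp⟩ := exists_forall_exp_le_quadratic hη
  -- With this `δ`, an increment truncated at level `t` and multiplied by `l t` is at most `s`.
  let δ : ℝ := s * r / √2
  have hδ : 0 < δ := by positivity
  refine ⟨δ, hδ, ?_⟩
  let ρ : ℝ := 1 + η
  have hρ : 1 < ρ := by simp only [ρ]; linarith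
  let l : ℝ → ℝ := fun t => √(2 * LL t / t) / r
  have hl : ∀ t, 0 ≤ l t := fun t => by positivity
  -- The increments are switched off once `τ_j` has passed the level `t`.
  let ψ : ℝ → ℕ → Ω → ℝ := fun t j ω => if sumSq T j ω ≤ t then l t * φ j ω else 0
  let ξ : ℝ → ℕ → Ω → ℝ := fun t j ω => if sumSq T j ω ≤ t then l t * truncTerm δ φ ε T j ω else 0
  have hψ : ∀ t j, Measurable[ℱ j] (ψ t j) := fun t j =>
    Measurable.ite (measurable_sumSq hT j measurableSet_Iic) ((hφ j).measurable.const_mul _)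
      measurable_const
  have hξ : ∀ t j, Measurable[ℱ (j + 1)] (ξ t j) := fun t j =>
    Measurable.ite (ℱ.mono (Nat.le_succ j) _ (measurable_sumSq hT j measurableSet_Iic))
      ((measurable_truncTerm hε hφ hT δ j).const_mul _) measurable_const
  have hle : ∀ t j ω, Real.exp (ξ t j ω) ≤
      1 + ψ t j ω * ε (j + 1) ω + (1 + η) / 2 * (ψ t j ω * ε (j + 1) ω) ^ 2 := by
    intro t j ω
    by_cases ht : sumSq T j ω ≤ t
    · simp only [ξ, ψ, ht, if_true, truncTerm]
      rw [mul_assoc (l t)]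
      split_ifs with hx
      · refine hexp _ ?_
        calc l t * (φ j ω * ε (j + 1) ω)
            ≤ l t * (δ * truncLevel t) := mul_le_mul_of_nonneg_left
              (hx.trans (mul_le_mul_of_nonneg_left (truncLevel_mono ht) hδ.le)) (hl t)
          _ = δ * (l t * truncLevel t) := by ring
          _ ≤ δ * (√2 / r) := by gcongr; exact sqrt_div_mul_truncLevel_le hr t
          _ = s := by simp only [δ]; field_simp
      · have hx0 : 0 ≤ φ j ω * ε (j + 1) ω :=
          le_trans (mul_nonneg hδ.le (truncLevel_nonneg _)) (not_le.1 hx).le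
        have := mul_nonneg (hl t) hx0
        rw [mul_zero, Real.exp_zero]
        nlinarith [mul_nonneg hη.le (sq_nonneg (l t * (φ j ω * ε (j + 1) ω)))]
    · simp [ξ, ψ, ht]
  have hBC : ∀ᵐ ω ∂μ, ∀ᶠ k : ℕ in atTop, ω ∉ {ω | ∃ n, (1 + η) * LL (ρ ^ k) ≤
      ∑ j ∈ Finset.range n, (ξ (ρ ^ k) j ω - (1 + η) / 2 * σ ^ 2 * ψ (ρ ^ k) j ω ^ 2)} := by
    refine ae_eventually_notMem (ne_of_lt ?_)
    refine lt_of_le_of_lt (ENNReal.tsum_le_tsum fun k =>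
      measure_exists_le_sum_le (by positivity) hε hvar (hψ _) (hξ _) (hle _) _) ?_
    exact (summable_exp_neg_LL_pow hρ hη).tsum_ofReal_lt_top
  filter_upwards [hBC, ae_all_iff.2 hφT, hτ] with ω hω hφTω hτω
  have hlarge : ∀ᶠ k : ℕ in atTop, LL (ρ ^ (k + 1)) ≤ (1 + η) * LL (ρ ^ k) ∧
      Real.exp (Real.exp 1) ≤ ρ ^ k ∧
      ∀ n, ∑ j ∈ Finset.range n, (ξ (ρ ^ (k + 1)) j ω -
        (1 + η) / 2 * σ ^ 2 * ψ (ρ ^ (k + 1)) j ω ^ 2) ≤ (1 + η) * LL (ρ ^ (k + 1)) := by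
    filter_upwards [eventually_LL_pow_succ_le hρ hη,
      (tendsto_pow_atTop_atTop_of_one_lt hρ).eventually_ge_atTop _,
      (tendsto_add_atTop_nat 1).eventually hω] with k h1 h2 h3
    refine ⟨h1, h2, fun n => ?_⟩
    simp only [not_exists, not_le] at h3
    exact (h3 n).le
  obtain ⟨k₀, hk₀⟩ := eventually_atTop.1 hlarge
  filter_upwards [hτω.eventually_ge_atTop (ρ ^ k₀)] with n hn
  set x := sumSq T n ω with hx
  -- Locate `τ_n` between consecutive geometric levels and use the bound for the upper one, `t`.
  obtain ⟨k, hk1, hk2⟩ := exists_nat_pow_near ((one_le_pow₀ hρ.le).trans hn) hρ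
  have hkk : k₀ ≤ k := by
    have := (pow_lt_pow_iff_right₀ hρ).1 (hn.trans_lt hk2)
    omega
  obtain ⟨hL, hee, hsum⟩ := hk₀ k hkk
  set t := ρ ^ (k + 1) with ht
  have htx : t ≤ (1 + η) * x := by
    rw [ht, pow_succ, mul_comm]; exact mul_le_mul_of_nonneg_left hk1 (by positivity)
  have heet : Real.exp (Real.exp 1) ≤ t := (hee.trans hk1).trans hk2.le
  have ht0 : 0 < t := (Real.exp_pos _).trans_le heet
  have hx0 : 0 < x := (Real.exp_pos _).trans_le (hee.trans hk1)
  have hLt := one_le_LL heet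
  have hLx : LL t ≤ (1 + η) * LL x :=
    hL.trans (mul_le_mul_of_nonneg_left (LL_mono (one_lt_exp_exp_one.trans_le hee) hk1)
      (by positivity))
  have hlt : 0 < l t := by simp only [l]; positivity
  have hl2 : l t ^ 2 * t * r ^ 2 = 2 * LL t := by
    simp only [l]
    rw [div_pow, Real.sq_sqrt (by positivity)]
    field_simp
  have hle_t : ∀ j ∈ Finset.range (n + 1), sumSq T j ω ≤ t := fun j hj =>
    (sumSq_mono T ω (Nat.lt_succ_iff.1 (Finset.mem_range.1 hj))).trans hk2.le
  have hmain : l t * ∑ j ∈ Finset.range (n + 1), truncTerm δ φ ε T j ω ≤ 2 * (1 + η) * LL t := by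
    have h := hsum (n + 1)
    rw [Finset.sum_sub_distrib, ← Finset.mul_sum] at h
    have e1 : ∑ j ∈ Finset.range (n + 1), ξ t j ω =
        l t * ∑ j ∈ Finset.range (n + 1), truncTerm δ φ ε T j ω := by
      rw [Finset.mul_sum]
      exact Finset.sum_congr rfl fun j hj => if_pos (hle_t j hj)
    have e2 : ∑ j ∈ Finset.range (n + 1), ψ t j ω ^ 2 ≤ l t ^ 2 * t := by
      calc ∑ j ∈ Finset.range (n + 1), ψ t j ω ^ 2
          ≤ ∑ j ∈ Finset.range (n + 1), l t ^ 2 * T j ω ^ 2 := by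
            refine Finset.sum_le_sum fun j hj => ?_
            simp only [ψ, hle_t j hj, if_true, mul_pow]
            gcongr ?_ * ?_
            exact sq_le_sq' (neg_le_of_abs_le (hφTω j)) (le_of_abs_le (hφTω j))
        _ = l t ^ 2 * x := by rw [← Finset.mul_sum]; rfl
        _ ≤ _ := by gcongr
    have e3 : σ ^ 2 * (l t ^ 2 * t) ≤ 2 * LL t := by
      calc σ ^ 2 * (l t ^ 2 * t) ≤ r ^ 2 * (l t ^ 2 * t) := by gcongr
        _ = 2 * LL t := by rw [← hl2]; ring
    have e4 : (1 + η) / 2 * σ ^ 2 * ∑ j ∈ Finset.range (n + 1), ψ t j ω ^ 2 ≤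
        (1 + η) * LL t := by
      calc _ ≤ (1 + η) / 2 * σ ^ 2 * (l t ^ 2 * t) := by gcongr
        _ = (1 + η) / 2 * (σ ^ 2 * (l t ^ 2 * t)) := by ring
        _ ≤ (1 + η) / 2 * (2 * LL t) := by gcongr
        _ = _ := by ring
    rw [e1] at h
    linarith
  have hsq : l t * (r * √(2 * t * LL t)) = 2 * LL t := by
    simp only [l]
    rw [div_mul_eq_mul_div, mul_left_comm, mul_div_cancel_left₀ _ hr.ne',
      ← Real.sqrt_mul (by positivity)]
    rw [show 2 * LL t / t * (2 * t * LL t) = (2 * LL t) ^ 2 by field_simp]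
    exact Real.sqrt_sq (by positivity)
  have hsqrt : √(2 * t * LL t) ≤ (1 + η) * √(2 * x * LL x) := by
    rw [← Real.sqrt_sq (by positivity : 0 ≤ 1 + η), ← Real.sqrt_mul (by positivity)]
    apply Real.sqrt_le_sqrt
    calc 2 * t * LL t ≤ 2 * ((1 + η) * x) * ((1 + η) * LL x) := by gcongr
      _ = _ := by ring
  have hfin : l t * ∑ j ∈ Finset.range (n + 1), truncTerm δ φ ε T j ω ≤
      l t * ((1 + η) * (r * √(2 * t * LL t))) := by
    refine hmain.trans_eq ?_
    rw [mul_left_comm, hsq]; ring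
  calc ∑ j ∈ Finset.range (n + 1), truncTerm δ φ ε T j ω
      ≤ (1 + η) * (r * √(2 * t * LL t)) := le_of_mul_le_mul_left hfin hlt
    _ ≤ (1 + η) * (r * ((1 + η) * √(2 * x * LL x))) := by gcongr
    _ = _ := by ring

/-! ### The part removed by the truncation -/

/-- Markov-type bound on a single removed increment: the exponent `2 + 2β` turns the excess over the
critical level into a term of the convergent series, measured on the scale `√(τ ln ln τ)`. -/
lemma removed_increment_le {β δ x w T τ : ℝ} (hβ : 0 < β) (hδ : 0 < δ) (hw : 0 ≤ w)
    (hT : 0 ≤ T) (hτ : Real.exp (Real.exp 1) ≤ τ) (hx : x ≤ T * w) :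
    x - (if x ≤ δ * truncLevel τ then x else 0) ≤
      δ ^ (-(1 + 2 * β)) * (T ^ (2 + 2 * β) * τ ^ (-1 - β) * LL τ ^ β * w ^ (2 + 2 * β)) *
        √(τ * LL τ) := by
  have hL := one_le_LL hτ
  have hL0 : 0 < LL τ := by linarith
  have hτ0 : 0 < τ := (Real.exp_pos _).trans_le hτ
  split_ifs with h
  · rw [sub_self]; positivity
  rw [sub_zero]
  rw [truncLevel, if_neg (not_lt.2 hτ), not_le] at h
  set c := √(τ / LL τ) with hc
  have hc0 : 0 < c := Real.sqrt_pos.2 (by positivity)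
  have hδc : 0 < δ * c := by positivity
  set s := T * w with hs
  have hs0 : δ * c ≤ s := h.le.trans hx
  have hspos : 0 < s := hδc.trans_le hs0
  have hcpow : c ^ (-(1 + 2 * β)) = τ ^ (-1 - β) * LL τ ^ β * √(τ * LL τ) := by
    rw [hc, Real.sqrt_eq_rpow, Real.sqrt_eq_rpow, ← Real.rpow_mul (by positivity),
      Real.div_rpow hτ0.le hL0.le, Real.mul_rpow hτ0.le hL0.le, div_eq_mul_inv,
      ← Real.rpow_neg hL0.le]
    rw [show τ ^ (-1 - β) * LL τ ^ β * (τ ^ (1 / 2 : ℝ) * LL τ ^ (1 / 2 : ℝ)) =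
      (τ ^ (-1 - β) * τ ^ (1 / 2 : ℝ)) * (LL τ ^ β * LL τ ^ (1 / 2 : ℝ)) by ring,
      ← Real.rpow_add hτ0, ← Real.rpow_add hL0]
    congr 2 <;> ring
  calc x ≤ s := hx
    _ = s ^ (2 + 2 * β) * s ^ (-(1 + 2 * β)) := by
        rw [← Real.rpow_add hspos, show 2 + 2 * β + -(1 + 2 * β) = 1 by ring, Real.rpow_one]
    _ ≤ s ^ (2 + 2 * β) * (δ * c) ^ (-(1 + 2 * β)) := by
        refine mul_le_mul_of_nonneg_left ?_ (by positivity)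
        exact Real.rpow_le_rpow_of_nonpos hδc hs0 (by linarith)
    _ = _ := by
        rw [Real.mul_rpow hδ.le hc0.le, hcpow, hs, Real.mul_rpow hT hw]
        ring

/-- The sum of the removed increments is negligible on the scale of the iterated logarithm. -/
lemma ae_eventually_sum_sub_truncTerm_le {Ω : Type*} {m0 : MeasurableSpace Ω} {μ : Measure Ω}
    [IsProbabilityMeasure μ] {ℱ : Filtration ℕ m0} {ε φ T : ℕ → Ω → ℝ} {β δ η : ℝ}
    (hβ : 0 < β) (hδ : 0 < δ) (hη : 0 < η)
    (hε : IsMartingaleDifference ε ℱ μ) (hT : StronglyAdapted ℱ T)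
    (hφT : ∀ n, ∀ᵐ ω ∂μ, |φ n ω| ≤ T n ω)
    (hτ : ∀ᵐ ω ∂μ, Tendsto (fun n => sumSq T n ω) atTop atTop)
    (hsum : ∀ᵐ ω ∂μ, Summable fun n =>
      T n ω ^ (2 + 2 * β) * sumSq T n ω ^ (-1 - β) * LL (sumSq T n ω) ^ β)
    (hmom : ∀ᵐ ω ∂μ,
      ⨆ n, (μ⁻[fun ω' => ENNReal.ofReal (|ε (n + 1) ω'| ^ (2 + 2 * β)) | ℱ n]) ω < ⊤) :
    ∀ᵐ ω ∂μ, ∀ᶠ n in atTop,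
      ∑ j ∈ Finset.range (n + 1), (φ j ω * ε (j + 1) ω - truncTerm δ φ ε T j ω) ≤
        2 * η * √(2 * sumSq T n ω * LL (sumSq T n ω)) := by
  let A : ℕ → Ω → ℝ := fun n ω =>
    T n ω ^ (2 + 2 * β) * sumSq T n ω ^ (-1 - β) * LL (sumSq T n ω) ^ β
  have hA : ∀ n, Measurable[ℱ n] (A n) := fun n =>
    (((hT n).measurable.pow_const _).mul ((measurable_sumSq hT n).pow_const _)).mul
      ((measurable_LL.comp (measurable_sumSq hT n)).pow_const _)
  have hW : ∀ n, Measurable fun ω => ENNReal.ofReal (|ε (n + 1) ω| ^ (2 + 2 * β)) := fun n =>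
    (((hε.measurable n).mono (ℱ.le (n + 1))).norm.measurable.pow_const _).ennreal_ofReal
  have hseries := ae_tsum_mul_lt_top (μ := μ) (ℱ := ℱ) (fun n => (hA n).ennreal_ofReal) hW
    (by filter_upwards [hsum] with ω hω using hω.tsum_ofReal_lt_top) hmom
  filter_upwards [hseries, ae_all_iff.2 hφT, hτ] with ω hω hφTω hτω
  set τ : ℕ → ℝ := fun n => sumSq T n ω with hτdef
  have hτmono : Monotone τ := sumSq_mono T ω
  let w : ℕ → ℝ := fun n => |ε (n + 1) ω| ^ (2 + 2 * β)
  let e : ℕ → ℝ := fun n => (ENNReal.ofReal (A n ω) * ENNReal.ofReal (w n)).toReal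
  have he : Summable e := ENNReal.summable_toReal hω.ne
  have he0 : ∀ n, 0 ≤ e n := fun n => ENNReal.toReal_nonneg
  have heA : ∀ n, A n ω * w n ≤ e n := fun n => by
    simp only [e, ENNReal.toReal_mul]
    rw [ENNReal.toReal_ofReal (by positivity : 0 ≤ w n)]
    refine mul_le_mul_of_nonneg_right ?_ (by positivity)
    rw [ENNReal.toReal_ofReal']
    exact le_max_left _ _
  let C : ℝ := δ ^ (-(1 + 2 * β))
  have hC : 0 < C := Real.rpow_pos_of_pos hδ _
  -- Beyond `J`, the series contributes at most `η` after multiplication by `C`. As the scale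
  -- `√(τ ln ln τ)` increases from `J` on, the removed increments after `J` add up to at most `η`
  -- times its last value.
  obtain ⟨J, hJ1, hJ2⟩ := ((hτω.eventually_ge_atTop (Real.exp (Real.exp 1))).and
    ((tendsto_sum_nat_add e).eventually_le_const (div_pos hη hC))).exists
  have hterm : ∀ j, J ≤ j → φ j ω * ε (j + 1) ω - truncTerm δ φ ε T j ω ≤
      C * e j * √(τ j * LL (τ j)) := by
    intro j hj
    have hT0 : 0 ≤ T j ω := (abs_nonneg _).trans (hφTω j)
    have hx : φ j ω * ε (j + 1) ω ≤ T j ω * |ε (j + 1) ω| := by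
      refine (le_abs_self _).trans ?_
      rw [abs_mul]
      exact mul_le_mul_of_nonneg_right (hφTω j) (abs_nonneg _)
    refine (removed_increment_le hβ hδ (abs_nonneg _) hT0 (hJ1.trans (hτmono hj)) hx).trans ?_
    refine mul_le_mul_of_nonneg_right ?_ (Real.sqrt_nonneg _)
    exact mul_le_mul_of_nonneg_left (heA j) hC.le
  set D := ∑ j ∈ Finset.range J, (φ j ω * ε (j + 1) ω - truncTerm δ φ ε T j ω) with hD
  have hbig : ∀ᶠ n in atTop, D / η ≤ √(2 * τ n * LL (τ n)) := by
    have h : Tendsto (fun x : ℝ => √(2 * x * LL x)) atTop atTop :=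
      Real.tendsto_sqrt_atTop.comp
        ((tendsto_id.const_mul_atTop two_pos).atTop_mul_atTop₀ tendsto_LL_atTop)
    exact (h.comp hτω).eventually_ge_atTop _
  filter_upwards [hbig, eventually_ge_atTop J] with n hn hJn
  rw [div_le_iff₀ hη] at hn
  have hee : Real.exp (Real.exp 1) ≤ τ n := hJ1.trans (hτmono hJn)
  have hLn := one_le_LL hee
  have hτ0 : 0 < τ n := (Real.exp_pos _).trans_le hee
  rw [← Finset.sum_range_add_sum_Ico _ (by omega : J ≤ n + 1)]
  have htail : ∑ j ∈ Finset.Ico J (n + 1), (φ j ω * ε (j + 1) ω - truncTerm δ φ ε T j ω) ≤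
      η * √(2 * τ n * LL (τ n)) := by
    calc _ ≤ ∑ j ∈ Finset.Ico J (n + 1), C * e j * √(2 * τ n * LL (τ n)) := by
          refine Finset.sum_le_sum fun j hj => ?_
          rw [Finset.mem_Ico] at hj
          refine (hterm j hj.1).trans ?_
          refine mul_le_mul_of_nonneg_left (Real.sqrt_le_sqrt ?_) (mul_nonneg hC.le (he0 j))
          have hjn : τ j ≤ τ n := hτmono (by omega)
          have heej := hJ1.trans (hτmono hj.1)
          have hLj := one_le_LL heej
          have hτj0 : 0 < τ j := (Real.exp_pos _).trans_le heej
          have hLL := LL_mono (one_lt_exp_exp_one.trans_le heej) hjn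
          have := mul_le_mul hjn hLL (by linarith) hτ0.le
          nlinarith [mul_pos hτ0 (by linarith : 0 < LL (τ n))]
      _ = C * (∑ j ∈ Finset.Ico J (n + 1), e j) * √(2 * τ n * LL (τ n)) := by
          rw [← Finset.sum_mul, ← Finset.mul_sum]
      _ ≤ C * (η / C) * √(2 * τ n * LL (τ n)) := by
          gcongr
          refine le_trans ?_ hJ2
          rw [Finset.sum_Ico_eq_sum_range]
          simp_rw [add_comm J]
          exact ((summable_nat_add_iff J).2 he).sum_le_tsum _ fun i _ => he0 _
      _ = _ := by field_simp
  change _ ≤ 2 * η * √(2 * τ n * LL (τ n))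
  linarith

/-! ### The law of the iterated logarithm -/

lemma ae_eventually_weightedSum_le {Ω : Type*} {m0 : MeasurableSpace Ω} {μ : Measure Ω}
    [IsProbabilityMeasure μ] {ℱ : Filtration ℕ m0} {ε φ T : ℕ → Ω → ℝ} {σ β R : ℝ}
    (hσ : 0 ≤ σ) (hβ : 0 < β) (hσR : σ < R)
    (hε : IsMartingaleDifference ε ℱ μ)
    (hφ : StronglyAdapted ℱ φ) (hT : StronglyAdapted ℱ T)
    (hφT : ∀ n, ∀ᵐ ω ∂μ, |φ n ω| ≤ T n ω)
    (hτ : ∀ᵐ ω ∂μ, Tendsto (fun n => sumSq T n ω) atTop atTop)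
    (hvar : ∀ n, ∀ᵐ ω ∂μ, (μ⁻[fun ω => ENNReal.ofReal (ε (n + 1) ω ^ 2) | ℱ n]) ω ≤
      ENNReal.ofReal (σ ^ 2))
    (hsum : ∀ᵐ ω ∂μ, Summable fun n =>
      T n ω ^ (2 + 2 * β) * sumSq T n ω ^ (-1 - β) * LL (sumSq T n ω) ^ β)
    (hmom : ∀ᵐ ω ∂μ,
      ⨆ n, (μ⁻[fun ω' => ENNReal.ofReal (|ε (n + 1) ω'| ^ (2 + 2 * β)) | ℱ n]) ω < ⊤) :
    ∀ᵐ ω ∂μ, ∀ᶠ n in atTop,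
      weightedSum φ ε (n + 1) ω ≤ R * √(2 * sumSq T n ω * LL (sumSq T n ω)) := by
  let r : ℝ := (σ + R) / 2
  have hσr : σ < r := by simp only [r]; linarith
  have hrR : r < R := by simp only [r]; linarith
  have hr : 0 < r := hσ.trans_lt hσr
  -- For `η ≤ 1`, the total constant `(1 + η)² r + 2η` is at most `r + η (3r + 2)`.
  let η : ℝ := min 1 ((R - r) / (3 * r + 2))
  have hη : 0 < η := lt_min one_pos (div_pos (by linarith) (by linarith))
  have hη1 : η ≤ 1 := min_le_left _ _
  have hη2 : η * (3 * r + 2) ≤ R - r := (le_div_iff₀ (by linarith)).1 (min_le_right _ _)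
  have hconst : (1 + η) ^ 2 * r + 2 * η ≤ R := by
    nlinarith [mul_nonneg (mul_nonneg hη.le (by linarith : 0 ≤ 1 - η)) hr.le]
  obtain ⟨δ, hδ, htrunc⟩ :=
    exists_ae_eventually_sum_truncTerm_le hσ hr hσr.le hη hε hφ hT hφT hτ hvar
  filter_upwards [htrunc, ae_eventually_sum_sub_truncTerm_le hβ hδ hη hε hT hφT hτ hsum hmom]
    with ω h1 h2
  filter_upwards [h1, h2] with n h1 h2
  rw [Finset.sum_sub_distrib] at h2
  have := mul_le_mul_of_nonneg_right hconst (Real.sqrt_nonneg (2 * sumSq T n ω * LL (sumSq T n ω)))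
  unfold weightedSum
  nlinarith

/-- The conditional expectations of the nonnegative variables `ε_{n+1}²` and
`|ε_{n+1}|^{2+2β}` are the `[0, ∞]`-valued ones, so no integrability is presupposed.
In the series, finitely many terms (those with `τ_n ≤ e`) do not affect summability. -/
theorem mainTheorem2 {Ω : Type*} {m0 : MeasurableSpace Ω} (μ : Measure Ω)
    [IsProbabilityMeasure μ] (ℱ : Filtration ℕ m0)
    (ε φ T : ℕ → Ω → ℝ) (σ β : ℝ) (hσ : 0 ≤ σ) (hβ : 0 < β)
    (hε : IsMartingaleDifference ε ℱ μ)
    (hφ : StronglyAdapted ℱ φ) (hT : StronglyAdapted ℱ T)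
    (hφT : ∀ n, ∀ᵐ ω ∂μ, |φ n ω| ≤ T n ω)
    (hτ : ∀ᵐ ω ∂μ, Tendsto (fun n => sumSq T n ω) atTop atTop)
    (hvar : ∀ᵐ ω ∂μ,
      ⨆ n, (μ⁻[fun ω' => ENNReal.ofReal (ε (n + 1) ω' ^ 2) | ℱ n]) ω ≤ ENNReal.ofReal (σ ^ 2))
    (hsum : ∀ᵐ ω ∂μ, Summable fun n =>
      T n ω ^ (2 + 2 * β) * sumSq T n ω ^ (-1 - β) * LL (sumSq T n ω) ^ β)
    (hmom : ∀ᵐ ω ∂μ,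
      ⨆ n, (μ⁻[fun ω' => ENNReal.ofReal (|ε (n + 1) ω'| ^ (2 + 2 * β)) | ℱ n]) ω < ⊤) :
    ∀ᵐ ω ∂μ,
      limsup (fun n =>
        (((2 * sumSq T n ω * LL (sumSq T n ω)) ^ (-(1 / 2) : ℝ) *
          |weightedSum φ ε (n + 1) ω| : ℝ) : EReal)) atTop ≤ (σ : EReal) := by
  have hvar' : ∀ n, ∀ᵐ ω ∂μ, (μ⁻[fun ω => ENNReal.ofReal (ε (n + 1) ω ^ 2) | ℱ n]) ω ≤
      ENNReal.ofReal (σ ^ 2) := fun n => by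
    filter_upwards [hvar] with ω hω
    exact (le_iSup (fun n => (μ⁻[fun ω => ENNReal.ofReal (ε (n + 1) ω ^ 2) | ℱ n]) ω) n).trans hω
  let R : ℕ → ℝ := fun m => σ + 1 / ((m : ℝ) + 1)
  have hR : ∀ m, σ < R m := fun m => lt_add_of_pos_right _ (by positivity)
  have hRlim : Tendsto (fun m => ((R m : ℝ) : EReal)) atTop (nhds (σ : EReal)) := by
    refine (continuous_coe_real_ereal.tendsto σ).comp ?_
    simpa [R] using tendsto_one_div_add_atTop_nhds_zero_nat.const_add σ
  have hup := ae_all_iff.2 fun m =>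
    ae_eventually_weightedSum_le hσ hβ (hR m) hε hφ hT hφT hτ hvar' hsum hmom
  have hlow := ae_all_iff.2 fun m =>
    ae_eventually_weightedSum_le (φ := fun n ω => -φ n ω) hσ hβ (hR m) hε (fun n => (hφ n).neg) hT
      (by simpa only [abs_neg] using hφT) hτ hvar' hsum hmom
  filter_upwards [hup, hlow, hτ] with ω h1 h2 hτω
  refine ge_of_tendsto' hRlim fun m => limsup_le_of_le (by isBoundedDefault) ?_
  filter_upwards [h1 m, h2 m, hτω.eventually_ge_atTop (Real.exp (Real.exp 1))] with n h1 h2 h3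
  have hneg : weightedSum (fun n ω => -φ n ω) ε (n + 1) ω = -weightedSum φ ε (n + 1) ω := by
    simp [weightedSum]
  rw [hneg] at h2
  have hpos : 0 < 2 * sumSq T n ω * LL (sumSq T n ω) :=
    mul_pos (mul_pos two_pos ((Real.exp_pos _).trans_le h3)) (by linarith [one_le_LL h3])
  rw [EReal.coe_le_coe_iff, Real.rpow_neg hpos.le, ← Real.sqrt_eq_rpow,
    inv_mul_le_iff₀ (Real.sqrt_pos.2 hpos), mul_comm]
  exact abs_le'.2 ⟨h1, h2⟩
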